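/- For a real linear space $E$ let $C(E)$ be the set of functions $f$ on $E$ whose restriction to every finite-dimensional linear subspace is continuous (in the coordinates of a basis of that subspace), and let $\Phi(E)$ be the set of positive definite functions on $E$, i.e. of all $f:E\to\mathbb{C}$ such that $\sum_{i,j=1}^m a_i f(\xi_i-\xi_j)\overline{a_j}\ge 0$ for all finite systems $\xi_1,\dots,\xi_m\in E$ and $a_1,\dots,a_m\in\mathbb{C}$. Let $\mathcal{L}^n$ be the set of all functions on $[0,\infty)^n$ of the form $$\varphi(u_1,\dots,u_n)=\int_{[0,\infty)^n} e^{-(u_1v_1+\dots+u_nv_n)}\,d\mu(v_1,\dots,v_n),$$ where $\mu$ is a finite nonnegative Borel measure on $[0,\infty)^n$. **Theorem.** Let $n\ge 1$ be an integer. For $k=1,\dots,n$ let $E_k$ be a real linear space, let $h_k\in C(E_k)$ be real-valued with $h_k(t)>0$ for all $t\in E_k$, and let $d_k\ge 1$ be an integer. Then the following statements are equivalent. 1. For every $\varphi\in\mathcal{L}^n$ the function $$K(x_1,\dots,x_n,t_1,\dots,t_n):=\varphi\left(\frac{\|x_1\|_2^2}{h_1(t_1)},\dots,\frac{\|x_n\|_2^2}{h_n(t_n)}\right)\prod_{k=1}^n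 h_k(t_k)^{-d_k/2}$$ belongs to $\Phi(\mathbb{R}^{d_1}\times\dots\times\mathbb{R}^{d_n}\times E_1\times\dots\times E_n)$, where $\|\cdot\|_2$ is the Euclidean norm. 2. For every $k=1,\dots,n$ and every $\lambda>0$, the function $t\mapsto e^{-\lambda h_k(t)}$ belongs to $\Phi(E_k)$. -/

import Mathlib

open scoped NNReal

/-- Positive definiteness of `f : E → ℂ`: for all finite systems of points `ξ i` and complex
numbers `a i`, the sum `∑ a i * f (ξ i - ξ j) * conj (a j)` is a nonnegative real number. -/
def IsPositiveDefiniteFun {E : Type*} [AddCommGroup E] (f : E → ℂ) : Prop :=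
  ∀ (m : ℕ) (ξ : Fin m → E) (a : Fin m → ℂ),
    0 ≤ (∑ i, ∑ j, a i * f (ξ i - ξ j) * starRingEnd ℂ (a j)).re ∧
      (∑ i, ∑ j, a i * f (ξ i - ξ j) * starRingEnd ℂ (a j)).im = 0

/-- The class `C(E)` for a real linear space `E` (of any dimension, without a given topology):
the restriction of `f` to every finite-dimensional subspace is continuous, in the coordinates of
any basis `e 0, …, e (m - 1)` of that subspace. -/
def IsFinitelyContinuous {E : Type*} [AddCommGroup E] [Module ℝ E] (f : E → ℝ) : Prop :=
  ∀ (m : ℕ) (e : Fin m → E), LinearIndependent ℝ e →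
    Continuous fun x : Fin m → ℝ => f (∑ i, x i • e i)

/-- `φ`, as a function on `[0, ∞)ⁿ`, is the Laplace transform of a finite nonnegative Borel measure
on `[0, ∞)ⁿ`. Values of `φ` outside `[0, ∞)ⁿ` play no role. -/
def IsMultivariateLaplace {n : ℕ} (φ : (Fin n → ℝ) → ℝ) : Prop :=
  ∃ μ : MeasureTheory.Measure (Fin n → ℝ≥0), MeasureTheory.IsFiniteMeasure μ ∧
    ∀ u : Fin n → ℝ, (∀ k, 0 ≤ u k) →
      φ u = ∫ v, Real.exp (-∑ k, u k * (v k : ℝ)) ∂μ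

open MeasureTheory Filter Topology
open scoped ComplexOrder

/-! ### Closure properties of positive definite functions. -/

namespace IsPositiveDefiniteFun

/-! Up to constants, `exp (-‖x‖² v / h t) * h t ^ (-d/2)` and `exp (-‖u‖² h t / (4v))` are Fourier
transforms of each other in `x` and `u`. From 2 to 1, the former is a superposition of products of a
character in `x` and some `exp (-λ h)`; taking products over `k` and integrating against `μ` gives
every `φ` (`exp_neg_mul_sq_norm_div`). From 1 to 2, a pure exponential `φ` isolates one index `k`,
and Fourier transforming in `x` at a unit vector recovers `exp (-l h)` (`exp_neg_mul_of_gaussian`).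
This preserves positivity because, with a factor `exp (-ε‖x‖²)` inserted, the integral is a positive
multiple of an average over differences of independent Gaussian vectors; then `ε → 0`. -/

theorem of_nonneg {E : Type*} [AddCommGroup E] {f : E → ℂ}
    (H : ∀ (m : ℕ) (ξ : Fin m → E) (a : Fin m → ℂ),
      0 ≤ ∑ i, ∑ j, a i * f (ξ i - ξ j) * starRingEnd ℂ (a j)) :
    IsPositiveDefiniteFun f := by
  intro m ξ a
  have h := Complex.nonneg_iff.1 (H m ξ a)
  exact ⟨h.1, h.2.symm⟩

theorem sum_nonneg {E : Type*} [AddCommGroup E] {f : E → ℂ} (hf : IsPositiveDefiniteFun f)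
    {ι : Type*} [Fintype ι] (ξ : ι → E) (a : ι → ℂ) :
    0 ≤ ∑ i, ∑ j, a i * f (ξ i - ξ j) * starRingEnd ℂ (a j) := by
  let e := (Fintype.equivFin ι).symm
  have h := hf _ (ξ ∘ e) (a ∘ e)
  have h' : 0 ≤ ∑ i, ∑ j, (a ∘ e) i * f ((ξ ∘ e) i - (ξ ∘ e) j) * starRingEnd ℂ ((a ∘ e) j) :=
    Complex.nonneg_iff.2 ⟨h.1, h.2.symm⟩
  convert h' using 1
  rw [← e.sum_comp]
  refine Finset.sum_congr rfl fun i _ => ?_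
  rw [← e.sum_comp]
  rfl

theorem map_neg {E : Type*} [AddCommGroup E] {f : E → ℂ} (hf : IsPositiveDefiniteFun f) (x : E) :
    f (-x) = starRingEnd ℂ (f x) := by
  have h0 := (hf 1 ![0] ![1]).2
  -- Weights `(1, 1)` control the imaginary part, `(1, I)` the real part.
  have h1 := (hf 2 ![x, 0] ![1, 1]).2
  have h2 := (hf 2 ![x, 0] ![1, Complex.I]).2
  simp [Fin.sum_univ_two] at h0 h1 h2
  apply Complex.ext <;> simp <;> linarith

theorem posSemidef {E : Type*} [AddCommGroup E] {f : E → ℂ} (hf : IsPositiveDefiniteFun f)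
    {ι : Type*} [Fintype ι] (ξ : ι → E) :
    (Matrix.of fun i j => f (ξ i - ξ j)).PosSemidef := by
  refine Matrix.PosSemidef.of_dotProduct_mulVec_nonneg ?_ fun x => ?_
  · ext i j
    simp [← hf.map_neg]
  · have := hf.sum_nonneg ξ (star x)
    simpa [dotProduct, Matrix.mulVec, Finset.mul_sum, mul_assoc] using this

theorem comp {E F : Type*} [AddCommGroup E] [AddCommGroup F] {f : F → ℂ}
    (hf : IsPositiveDefiniteFun f) (g : E →+ F) : IsPositiveDefiniteFun fun x => f (g x) :=
  of_nonneg fun m ξ a => by simpa using hf.sum_nonneg (fun i => g (ξ i)) a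

/-- Schur product theorem. -/
theorem mul {E : Type*} [AddCommGroup E] {f g : E → ℂ}
    (hf : IsPositiveDefiniteFun f) (hg : IsPositiveDefiniteFun g) :
    IsPositiveDefiniteFun fun x => f x * g x := by
  refine of_nonneg fun m ξ a => ?_
  have := ((hf.posSemidef ξ).hadamard (hg.posSemidef ξ)).dotProduct_mulVec_nonneg (star a)
  simpa [dotProduct, Matrix.mulVec, Finset.mul_sum, mul_assoc] using this

theorem const {E : Type*} [AddCommGroup E] {c : ℝ} (hc : 0 ≤ c) :
    IsPositiveDefiniteFun fun _ : E => (c : ℂ) := by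
  refine of_nonneg fun m ξ a => ?_
  have : ∑ i, ∑ j, a i * (c : ℂ) * starRingEnd ℂ (a j)
      = ((c * Complex.normSq (∑ i, a i) : ℝ) : ℂ) := by
    push_cast
    rw [← Complex.mul_conj, map_sum, Finset.sum_mul_sum, Finset.mul_sum]
    simp_rw [Finset.mul_sum]
    refine Finset.sum_congr rfl fun i _ => Finset.sum_congr rfl fun j _ => by ring
  rw [this]
  exact Complex.zero_le_real.2 (mul_nonneg hc (Complex.normSq_nonneg _))

theorem prod {E : Type*} [AddCommGroup E] {ι : Type*} (s : Finset ι) {f : ι → E → ℂ}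
    (hf : ∀ i ∈ s, IsPositiveDefiniteFun (f i)) :
    IsPositiveDefiniteFun fun x => ∏ i ∈ s, f i x := by
  classical
  induction s using Finset.induction_on with
  | empty => simpa using const (E := E) zero_le_one
  | insert i s hi ih =>
    simp only [Finset.prod_insert hi]
    exact (hf i (Finset.mem_insert_self i s)).mul
      (ih fun j hj => hf j (Finset.mem_insert_of_mem hj))

theorem of_tendsto {E : Type*} [AddCommGroup E] {ι : Type*} {l : Filter ι} [l.NeBot]
    {F : ι → E → ℂ} {f : E → ℂ} (hF : ∀ᶠ i in l, IsPositiveDefiniteFun (F i))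
    (h : ∀ x, Tendsto (fun i => F i x) l (𝓝 (f x))) : IsPositiveDefiniteFun f := by
  refine of_nonneg fun m ξ a => ?_
  refine ge_of_tendsto (b := (0 : ℂ)) (x := l)
    (f := fun n => ∑ i, ∑ j, a i * F n (ξ i - ξ j) * starRingEnd ℂ (a j)) ?_
    (hF.mono fun n hn => hn.sum_nonneg ξ a)
  exact tendsto_finsetSum _ fun i _ => tendsto_finsetSum _ fun j _ =>
    ((h _).const_mul _).mul_const _

theorem integral {E : Type*} [AddCommGroup E] {X : Type*} [MeasurableSpace X] {μ : Measure X}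
    {F : X → E → ℂ} (hF : ∀ x, IsPositiveDefiniteFun (F x))
    (hint : ∀ t, Integrable (fun x => F x t) μ) :
    IsPositiveDefiniteFun fun t => ∫ x, F x t ∂μ := by
  refine of_nonneg fun m ξ a => ?_
  have : ∑ i, ∑ j, a i * (∫ x, F x (ξ i - ξ j) ∂μ) * starRingEnd ℂ (a j)
      = ∫ x, ∑ i, ∑ j, a i * F x (ξ i - ξ j) * starRingEnd ℂ (a j) ∂μ := by
    have hi : ∀ i j, Integrable
        (fun x => a i * F x (ξ i - ξ j) * starRingEnd ℂ (a j)) μ :=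
      fun i j => ((hint _).const_mul _).mul_const _
    rw [integral_finsetSum _ fun i _ => integrable_finsetSum _ fun j _ => hi i j]
    refine Finset.sum_congr rfl fun i _ => ?_
    rw [integral_finsetSum _ fun j _ => hi i j]
    refine Finset.sum_congr rfl fun j _ => ?_
    rw [integral_mul_const, integral_const_mul]
  rw [this]
  exact integral_nonneg fun x => (hF x).sum_nonneg ξ a

/-- A character is absorbed into the weights, which reduces to the constant `1`. -/
theorem exp_inner {V : Type*} [NormedAddCommGroup V] [InnerProductSpace ℝ V] (u : V) :
    IsPositiveDefiniteFun fun x : V => Complex.exp (Complex.I * (inner ℝ x u : ℝ)) := by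
  refine of_nonneg fun m ξ a => ?_
  have h := (const (E := V) zero_le_one).sum_nonneg ξ
    (fun i => a i * Complex.exp (Complex.I * (inner ℝ (ξ i) u : ℝ)))
  convert h using 1
  refine Finset.sum_congr rfl fun i _ => Finset.sum_congr rfl fun j _ => ?_
  rw [inner_sub_left, map_mul, ← Complex.exp_conj]
  simp only [map_mul, Complex.conj_I, Complex.conj_ofReal, Complex.ofReal_sub, mul_sub,
    Complex.exp_sub, neg_mul, Complex.exp_neg, Complex.ofReal_one, mul_one]
  ring

end IsPositiveDefiniteFun

/-! ### From finite sums to double integrals. -/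

/-- Average the hypothesis over `N` independent samples of `P`: the `N` diagonal terms are
negligible against the `N(N-1)` others, so no continuity of `G` is needed. -/
theorem MeasureTheory.integral_nonneg_of_sum_nonneg {X : Type*} [MeasurableSpace X]
    (P : Measure X) [IsProbabilityMeasure P] {G : X × X → ℂ} (hG : Measurable G) {C : ℝ}
    (hC : ∀ z, ‖G z‖ ≤ C)
    (H : ∀ (N : ℕ) (x : Fin N → X), 0 ≤ ∑ i, ∑ j, G (x i, x j)) :
    0 ≤ ∫ z, G z ∂P.prod P := by
  set D : ℂ := ∫ x, G (x, x) ∂P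
  set J : ℂ := ∫ z, G z ∂P.prod P
  have hdiag : Measurable fun x : X => G (x, x) := hG.comp (measurable_id.prodMk measurable_id)
  have key : ∀ N : ℕ, 0 ≤ (N : ℂ) * D + N * (N - 1) * J := by
    intro N
    let Q : Measure (Fin N → X) := Measure.pi fun _ => P
    have hmeas : ∀ i j, Measurable fun x : Fin N → X => G (x i, x j) := fun i j =>
      hG.comp ((measurable_pi_apply i).prodMk (measurable_pi_apply j))
    have hint : ∀ i j, Integrable (fun x : Fin N → X => G (x i, x j)) Q := fun i j =>
      Integrable.of_bound (hmeas i j).aestronglyMeasurable C (Eventually.of_forall fun x => hC _)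
    have hval : ∀ i j : Fin N, ∫ x, G (x i, x j) ∂Q = if i = j then D else J := by
      intro i j
      split_ifs with hij
      · subst hij
        have hp := measurePreserving_eval (fun _ : Fin N => P) i
        have := integral_map (μ := Q) hp.measurable.aemeasurable (f := fun y => G (y, y))
          hdiag.aestronglyMeasurable
        rw [hp.map_eq] at this
        exact this.symm
      · have hind : ProbabilityTheory.iIndepFun (fun (i : Fin N) (x : Fin N → X) => x i) Q :=
          ProbabilityTheory.iIndepFun_pi (X := fun _ x => x) fun _ => aemeasurable_id
        have h2 := hind.indepFun hij
        rw [ProbabilityTheory.indepFun_iff_map_prod_eq_prod_map_map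
          (measurable_pi_apply i).aemeasurable (measurable_pi_apply j).aemeasurable] at h2
        have hp := (measurePreserving_eval (fun _ : Fin N => P) i).map_eq
        have hp' := (measurePreserving_eval (fun _ : Fin N => P) j).map_eq
        have := integral_map (μ := Q) (φ := fun x => (x i, x j))
          ((measurable_pi_apply i).prodMk (measurable_pi_apply j)).aemeasurable (f := G)
          hG.aestronglyMeasurable
        rw [h2] at this
        change Measure.map (fun x => x i) Q = P at hp
        change Measure.map (fun x => x j) Q = P at hp'
        rw [hp, hp'] at this
        exact this.symm
    have hsum : ∫ x, ∑ i, ∑ j, G (x i, x j) ∂Q = (N : ℂ) * D + N * (N - 1) * J := by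
      rw [integral_finsetSum _ fun i _ => integrable_finsetSum _ fun j _ => hint i j]
      have : ∀ i : Fin N, ∫ x, ∑ j, G (x i, x j) ∂Q = D + (N - 1) * J := by
        intro i
        rw [integral_finsetSum _ fun j _ => hint i j]
        simp_rw [hval]
        have : ∀ j, (if i = j then D else J) = (if i = j then D - J else 0) + J := by
          intro j; split_ifs <;> ring
        simp_rw [this, Finset.sum_add_distrib]
        simp
        ring
      simp_rw [this]
      simp
      ring
    rw [← hsum]
    exact integral_nonneg fun x => H N x
  have hlim : Tendsto (fun n : ℕ => ((n + 1 : ℕ) : ℝ)⁻¹ • D + J) atTop (𝓝 ((0 : ℝ) • D + J)) :=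
    (((tendsto_inv_atTop_zero.comp
      (tendsto_natCast_atTop_atTop.comp (tendsto_add_atTop_nat 1))).smul_const D).add_const J)
  rw [zero_smul, zero_add] at hlim
  refine ge_of_tendsto' hlim fun n => ?_
  -- With `N = n + 2`, dividing by `N(N-1)` is legitimate and leaves `D/(n+1) + J`.
  have h := key (n + 2)
  have h' : (0 : ℂ) ≤ (((((n + 2 : ℕ) : ℝ) * ((n + 1 : ℕ) : ℝ))⁻¹ : ℝ) : ℂ) :=
    Complex.zero_le_real.2 (by positivity)
  convert mul_nonneg h' h using 1
  have h1 : ((n : ℂ) + 1) ≠ 0 := by exact_mod_cast Nat.succ_ne_zero n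
  have h2 : ((n : ℂ) + 2) ≠ 0 := by exact_mod_cast Nat.succ_ne_zero (n + 1)
  simp only [Complex.real_smul]
  push_cast
  field_simp
  ring

/-! ### Gaussian Fourier transform and the implication from 2 to 1. -/

section Gaussian

variable {V : Type*} [NormedAddCommGroup V] [InnerProductSpace ℝ V] [FiniteDimensional ℝ V]
  [MeasurableSpace V] [BorelSpace V]

theorem integrable_exp_inner_mul_gaussian {b : ℝ} (hb : 0 < b) (y : V) :
    Integrable fun u : V =>
      Complex.exp (Complex.I * (inner ℝ y u : ℝ)) * (Real.exp (-b * ‖u‖ ^ 2) : ℂ) := by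
  convert GaussianFourier.integrable_cexp_neg_mul_sq_norm_add (b := (b : ℂ)) (by simpa) Complex.I y
    using 2 with u
  rw [Complex.ofReal_exp, ← Complex.exp_add]
  push_cast
  ring_nf

theorem integral_exp_inner_mul_gaussian {b : ℝ} (hb : 0 < b) (y : V) :
    ∫ u : V, Complex.exp (Complex.I * (inner ℝ y u : ℝ)) * (Real.exp (-b * ‖u‖ ^ 2) : ℂ) =
      (((Real.pi / b) ^ ((Module.finrank ℝ V : ℝ) / 2) * Real.exp (-‖y‖ ^ 2 / (4 * b)) : ℝ) : ℂ) := by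
  have h := GaussianFourier.integral_cexp_neg_mul_sq_norm_add (b := (b : ℂ)) (by simpa) Complex.I y
  convert h using 1
  · refine integral_congr_ae (Eventually.of_forall fun u => ?_)
    simp only []
    rw [Complex.ofReal_exp, ← Complex.exp_add]
    push_cast
    ring_nf
  · rw [Complex.ofReal_mul, Complex.ofReal_cpow (by positivity)]
    push_cast
    rw [Complex.I_sq]
    ring_nf

end Gaussian

theorem IsPositiveDefiniteFun.exp_neg_mul_sq_norm_div {E : Type*} [AddCommGroup E] {h : E → ℝ}
    (hpos : ∀ t, 0 < h t) (d : ℕ)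
    (H : ∀ l : ℝ, 0 < l → IsPositiveDefiniteFun fun t => ((Real.exp (-l * h t) : ℝ) : ℂ))
    {v : ℝ} (hv : 0 ≤ v) :
    IsPositiveDefiniteFun fun p : EuclideanSpace ℝ (Fin d) × E =>
      ((Real.exp (-(‖p.1‖ ^ 2 / h p.2 * v)) * h p.2 ^ (-(d : ℝ) / 2) : ℝ) : ℂ) := by
  have H0 : ∀ l : ℝ, 0 ≤ l →
      IsPositiveDefiniteFun fun t => ((Real.exp (-l * h t) : ℝ) : ℂ) := by
    intro l hl
    rcases hl.eq_or_lt with rfl | hl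
    · simpa using IsPositiveDefiniteFun.const (E := E) zero_le_one
    · exact H l hl
  have main : ∀ w : ℝ, 0 < w → IsPositiveDefiniteFun fun p : EuclideanSpace ℝ (Fin d) × E =>
      ((Real.exp (-(‖p.1‖ ^ 2 / h p.2 * w)) * h p.2 ^ (-(d : ℝ) / 2) : ℝ) : ℂ) := by
    intro w hw
    have hI := IsPositiveDefiniteFun.integral (μ := (volume : Measure (EuclideanSpace ℝ (Fin d))))
      (F := fun u (p : EuclideanSpace ℝ (Fin d) × E) =>
        Complex.exp (Complex.I * (inner ℝ p.1 u : ℝ)) *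
          (Real.exp (-(h p.2 / (4 * w)) * ‖u‖ ^ 2) : ℂ))
      (fun u => by
        refine ((IsPositiveDefiniteFun.exp_inner u).comp (AddMonoidHom.fst _ E)).mul ?_
        convert (H0 (‖u‖ ^ 2 / (4 * w)) (by positivity)).comp
          (AddMonoidHom.snd (EuclideanSpace ℝ (Fin d)) E) using 4
        simp only [AddMonoidHom.coe_snd]
        ring)
      (fun p => integrable_exp_inner_mul_gaussian (by have := hpos p.2; positivity) p.1)
    have hc : 0 ≤ ((4 * Real.pi * w) ^ ((d : ℝ) / 2))⁻¹ := by positivity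
    convert (IsPositiveDefiniteFun.const hc).mul hI using 2 with p
    have hp := hpos p.2
    rw [integral_exp_inner_mul_gaussian (by positivity), ← Complex.ofReal_mul]
    congr 1
    rw [finrank_euclideanSpace_fin,
      show Real.pi / (h p.2 / (4 * w)) = (4 * Real.pi * w) * (h p.2)⁻¹ by field_simp,
      Real.mul_rpow (x := 4 * Real.pi * w) (by positivity) (by positivity),
      Real.inv_rpow hp.le, neg_div,
      Real.rpow_neg hp.le,
      show -‖p.1‖ ^ 2 / (4 * (h p.2 / (4 * w))) = -(‖p.1‖ ^ 2 / h p.2 * w) by field_simp]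
    have : (4 * Real.pi * w) ^ ((d : ℝ) / 2) ≠ 0 := by positivity
    field_simp
  -- The Fourier formula needs a positive parameter; `v = 0` is reached as a limit.
  refine IsPositiveDefiniteFun.of_tendsto (l := 𝓝[>] (0 : ℝ))
    (F := fun ε (p : EuclideanSpace ℝ (Fin d) × E) =>
      ((Real.exp (-(‖p.1‖ ^ 2 / h p.2 * (v + ε))) * h p.2 ^ (-(d : ℝ) / 2) : ℝ) : ℂ)) ?_ ?_
  · filter_upwards [self_mem_nhdsWithin] with ε hε
    exact main _ (add_pos_of_nonneg_of_pos hv hε)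
  · intro p
    refine Tendsto.mono_left ?_ nhdsWithin_le_nhds
    refine Continuous.tendsto' ?_ _ _ (by simp)
    fun_prop

/-! ### Gaussian regularisation and the implication from 1 to 2. -/

section Gaussian

variable {V : Type*} [NormedAddCommGroup V] [InnerProductSpace ℝ V] [FiniteDimensional ℝ V]
  [MeasurableSpace V] [BorelSpace V]

theorem integrable_gaussian {b : ℝ} (hb : 0 < b) :
    Integrable fun u : V => Real.exp (-b * ‖u‖ ^ 2) := by
  have := (integrable_exp_inner_mul_gaussian hb (0 : V)).re
  simpa [← Complex.ofReal_exp, ← Complex.ofReal_neg, ← Complex.ofReal_pow, ← Complex.ofReal_mul,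
    -Complex.ofReal_neg, -Complex.ofReal_pow, -Complex.ofReal_mul, -Complex.ofReal_exp] using this

/-- Averaging a function of `x - x'` over two independent Gaussian vectors. -/
theorem exists_gaussian_measure {ε : ℝ} (hε : 0 < ε) :
    ∃ P : Measure V, IsProbabilityMeasure P ∧ ∃ C : ℝ, 0 < C ∧
      ∀ g : V → ℂ, Continuous g → (∃ B, ∀ x, ‖g x‖ ≤ B) →
        ∫ z, g (z.1 - z.2) ∂P.prod P =
          C * ∫ u, g u * (Real.exp (-ε * ‖u‖ ^ 2) : ℂ) := by
  have h2 : 0 < 2 * ε := by positivity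
  have h4 : 0 < 4 * ε := by positivity
  set w : V → ℝ := fun u => Real.exp (-(2 * ε) * ‖u‖ ^ 2) with hw
  have hwi : Integrable w := integrable_gaussian h2
  have hwpos : 0 < ∫ u, w u := integral_exp_pos hwi
  set c : ℝ := (∫ u, w u)⁻¹ with hc
  have hcpos : 0 < c := inv_pos.2 hwpos
  let ρ : V → ℝ≥0 := fun u => (c * w u).toNNReal
  have hρm : Measurable ρ := by fun_prop
  have hρ : ∀ u, (ρ u : ℝ) = c * w u := fun u =>
    Real.coe_toNNReal _ (mul_nonneg hcpos.le (Real.exp_pos _).le)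
  let P : Measure V := volume.withDensity fun u => (ρ u : ENNReal)
  have hP : IsProbabilityMeasure P := by
    constructor
    rw [withDensity_apply _ MeasurableSet.univ, setLIntegral_univ]
    change ∫⁻ u, ENNReal.ofReal (c * w u) = 1
    rw [← ofReal_integral_eq_lintegral_ofReal (hwi.const_mul c)
      (Eventually.of_forall fun u => mul_nonneg hcpos.le (Real.exp_pos _).le),
      integral_const_mul, hc, inv_mul_cancel₀ hwpos.ne', ENNReal.ofReal_one]
  have hPint : ∀ f : V → ℂ, ∫ u, f u ∂P = ∫ u, ((c * w u : ℝ) : ℂ) * f u := by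
    intro f
    rw [integral_withDensity_eq_integral_smul hρm]
    refine integral_congr_ae (Eventually.of_forall fun u => ?_)
    simp only [NNReal.smul_def, hρ, Complex.real_smul]
  have hKpos : 0 < ∫ u : V, Real.exp (-(4 * ε) * ‖u‖ ^ 2) :=
    integral_exp_pos (integrable_gaussian h4)
  refine ⟨P, hP, c ^ 2 * ∫ u : V, Real.exp (-(4 * ε) * ‖u‖ ^ 2), by positivity, ?_⟩
  rintro g hg ⟨B, hB⟩
  have hgi : Integrable (fun z : V × V => g (z.1 - z.2)) (P.prod P) :=
    Integrable.of_bound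
      (hg.comp (continuous_fst.sub continuous_snd)).aestronglyMeasurable B
      (Eventually.of_forall fun z => hB _)
  -- Completing the square: the rate `2ε` in `w` is chosen so that its autocorrelation has rate `ε`.
  have hsplit : ∀ u x : V, w (u + x) * w x =
      Real.exp (-ε * ‖u‖ ^ 2) * Real.exp (-(4 * ε) * ‖x + (2⁻¹ : ℝ) • u‖ ^ 2) := by
    intro u x
    simp only [hw]
    rw [← Real.exp_add, ← Real.exp_add, norm_add_sq_real, norm_add_sq_real, norm_smul,
      real_inner_smul_right, real_inner_comm]
    congr 1
    norm_num
    ring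
  have hint : Integrable (Function.uncurry fun x u : V =>
      ((w (u + x) * w x : ℝ) : ℂ) * g u) := by
    have hF : Integrable (fun z : V × V => ((w z.1 * w z.2 : ℝ) : ℂ)) :=
      (hwi.mul_prod hwi).ofReal
    have hF2 : Integrable (fun z : V × V => ((w (z.2 + z.1) * w z.1 : ℝ) : ℂ)) := by
      have hmp := (measurePreserving_prod_add (volume : Measure V) volume).integrable_comp_of_integrable
        hF
      refine hmp.congr (Eventually.of_forall fun z => ?_)
      simp [add_comm, mul_comm]
    refine (hF2.bdd_mul (c := B) (f := fun z : V × V => g z.2)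
      (hg.comp continuous_snd).aestronglyMeasurable (Eventually.of_forall fun z => hB _)).congr
      (Eventually.of_forall fun z => ?_)
    simp [Function.uncurry, mul_comm]
  rw [integral_prod_symm _ hgi, hPint]
  simp_rw [hPint]
  have h1 : ∀ x : V, ((c * w x : ℝ) : ℂ) * ∫ x', ((c * w x' : ℝ) : ℂ) * g (x' - x) =
      (c : ℂ) ^ 2 * ∫ u, ((w (u + x) * w x : ℝ) : ℂ) * g u := by
    intro x
    rw [← integral_add_right_eq_self _ x, ← integral_const_mul, ← integral_const_mul]
    refine integral_congr_ae (Eventually.of_forall fun u => ?_)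
    simp only [add_sub_cancel_right]
    push_cast
    ring
  simp_rw [h1]
  rw [integral_const_mul, integral_integral_swap hint]
  have h3 : ∀ u : V, ∫ x, ((w (u + x) * w x : ℝ) : ℂ) * g u =
      ((∫ x : V, Real.exp (-(4 * ε) * ‖x‖ ^ 2) : ℝ) : ℂ) *
        (g u * (Real.exp (-ε * ‖u‖ ^ 2) : ℂ)) := by
    intro u
    simp_rw [hsplit]
    rw [integral_mul_const, integral_complex_ofReal, integral_const_mul,
      integral_add_right_eq_self (fun x : V => Real.exp (-(4 * ε) * ‖x‖ ^ 2))]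
    push_cast
    ring
  simp_rw [h3]
  rw [integral_const_mul]
  push_cast
  ring

end Gaussian

theorem IsPositiveDefiniteFun.exp_neg_mul_of_gaussian {E : Type*} [AddCommGroup E] {h : E → ℝ}
    (hpos : ∀ t, 0 < h t) {d : ℕ} (hd : 1 ≤ d) {l : ℝ} (hl : 0 < l)
    (H : IsPositiveDefiniteFun fun p : EuclideanSpace ℝ (Fin d) × E =>
      ((Real.exp (-(‖p.1‖ ^ 2 / h p.2 * (4 * l)⁻¹)) * h p.2 ^ (-(d : ℝ) / 2) : ℝ) : ℂ)) :
    IsPositiveDefiniteFun fun t => ((Real.exp (-l * h t) : ℝ) : ℂ) := by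
  let V := EuclideanSpace ℝ (Fin d)
  -- The frequency must be nonzero, hence `1 ≤ d`; with norm `1` and rate `(4l)⁻¹ / h t`, the
  -- transform contains exactly `exp (-l * h t)`.
  obtain ⟨y, hy⟩ : ∃ y : EuclideanSpace ℝ (Fin d), ‖y‖ = 1 :=
    ⟨EuclideanSpace.single ⟨0, hd⟩ 1, by simp⟩
  set b : ℝ → E → ℝ := fun ε t => (4 * l)⁻¹ / h t + ε with hb
  have hbpos : ∀ ε, 0 ≤ ε → ∀ t, 0 < b ε t := fun ε hε t => by have := hpos t; positivity
  set f : ℝ → E → ℝ := fun ε t =>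
    ((Real.pi / b ε t) ^ ((d : ℝ) / 2) * Real.exp (-1 / (4 * b ε t))) * h t ^ (-(d : ℝ) / 2)
    with hf
  have main : ∀ ε, 0 < ε → IsPositiveDefiniteFun fun t => (f ε t : ℂ) := by
    intro ε hε
    obtain ⟨P, hP, C, hC, hint⟩ := exists_gaussian_measure (V := V) hε
    refine of_nonneg fun m ξ a => ?_
    let k : E → V → ℂ := fun t x => Complex.exp (Complex.I * (inner ℝ y x : ℝ)) *
      ((Real.exp (-(‖x‖ ^ 2 / h t * (4 * l)⁻¹)) * h t ^ (-(d : ℝ) / 2) : ℝ) : ℂ)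
    have hkc : ∀ t, Continuous (k t) := by intro t; fun_prop
    have hkB : ∀ t x, ‖k t x‖ ≤ h t ^ (-(d : ℝ) / 2) := by
      intro t x
      have ht := hpos t
      rw [norm_mul, mul_comm Complex.I, Complex.norm_exp_ofReal_mul_I, one_mul, Complex.norm_real,
        Real.norm_of_nonneg (by positivity)]
      refine mul_le_of_le_one_left (by positivity) (Real.exp_le_one_iff.2 ?_)
      rw [neg_nonpos]
      positivity
    let g : V → ℂ := fun x => ∑ i, ∑ j, a i * k (ξ i - ξ j) x * starRingEnd ℂ (a j)
    have hgc : Continuous g := by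
      refine continuous_finsetSum _ fun i _ => continuous_finsetSum _ fun j _ => ?_
      exact (continuous_const.mul (hkc _)).mul continuous_const
    have hgB : ∀ x, ‖g x‖ ≤ ∑ i, ∑ j,
        ‖a i‖ * h (ξ i - ξ j) ^ (-(d : ℝ) / 2) * ‖starRingEnd ℂ (a j)‖ := by
      intro x
      refine (norm_sum_le _ _).trans (Finset.sum_le_sum fun i _ => (norm_sum_le _ _).trans
        (Finset.sum_le_sum fun j _ => ?_))
      rw [norm_mul, norm_mul]
      gcongr
      exact hkB _ _
    have hpos' : 0 ≤ ∫ z, g (z.1 - z.2) ∂P.prod P := by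
      refine MeasureTheory.integral_nonneg_of_sum_nonneg P (G := fun z => g (z.1 - z.2))
        (hgc.measurable.comp (measurable_fst.sub measurable_snd)) (fun z => hgB _) fun N x => ?_
      have hk : IsPositiveDefiniteFun fun p : V × E => k p.2 p.1 := by
        refine IsPositiveDefiniteFun.mul ?_ H
        convert (IsPositiveDefiniteFun.exp_inner y).comp (AddMonoidHom.fst V E) using 5
        exact real_inner_comm _ _
      -- Test on the grid of all pairs of a sample and a `ξ i`, with weights independent of the
      -- sample.
      have := hk.sum_nonneg (ι := Fin N × Fin m) (fun q => (x q.1, ξ q.2)) (fun q => a q.2)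
      simp only [Fintype.sum_prod_type, Prod.mk_sub_mk] at this
      convert this using 1
      refine Finset.sum_congr rfl fun α _ => ?_
      rw [Finset.sum_comm]
    rw [hint g hgc ⟨_, hgB⟩] at hpos'
    have hki : ∀ t, ∫ x, k t x * (Real.exp (-ε * ‖x‖ ^ 2) : ℂ) = (f ε t : ℂ) := by
      intro t
      have h1 := integral_exp_inner_mul_gaussian (hbpos ε hε.le t) y
      rw [hy, finrank_euclideanSpace_fin, one_pow] at h1
      simp only [hf]
      rw [Complex.ofReal_mul, ← h1, ← integral_mul_const]
      refine integral_congr_ae (Eventually.of_forall fun x => ?_)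
      have : Real.exp (-b ε t * ‖x‖ ^ 2) =
          Real.exp (-(‖x‖ ^ 2 / h t * (4 * l)⁻¹)) * Real.exp (-ε * ‖x‖ ^ 2) := by
        rw [← Real.exp_add]
        congr 1
        simp only [hb]
        ring
      simp only [k, this]
      push_cast
      ring
    have hgint : ∫ x, g x * (Real.exp (-ε * ‖x‖ ^ 2) : ℂ) =
        ∑ i, ∑ j, a i * (f ε (ξ i - ξ j) : ℂ) * starRingEnd ℂ (a j) := by
      have hi : ∀ i j, Integrable fun x => a i * starRingEnd ℂ (a j) *
          (k (ξ i - ξ j) x * (Real.exp (-ε * ‖x‖ ^ 2) : ℂ)) := fun i j =>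
        (((integrable_gaussian hε).ofReal).bdd_mul (hkc _).aestronglyMeasurable
          (Eventually.of_forall fun x => hkB (ξ i - ξ j) x)).const_mul _
      have hgx : ∀ x, g x * (Real.exp (-ε * ‖x‖ ^ 2) : ℂ) = ∑ i, ∑ j, a i * starRingEnd ℂ (a j) *
          (k (ξ i - ξ j) x * (Real.exp (-ε * ‖x‖ ^ 2) : ℂ)) := by
        intro x
        simp only [g, Finset.sum_mul]
        exact Finset.sum_congr rfl fun i _ => Finset.sum_congr rfl fun j _ => by ring
      simp_rw [hgx]
      rw [integral_finsetSum _ fun i _ => integrable_finsetSum _ fun j _ => hi i j]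
      refine Finset.sum_congr rfl fun i _ => ?_
      rw [integral_finsetSum _ fun j _ => hi i j]
      refine Finset.sum_congr rfl fun j _ => ?_
      rw [integral_const_mul, hki]
      ring
    rw [hgint] at hpos'
    have := mul_nonneg (Complex.zero_le_real.2 (inv_nonneg.2 hC.le)) hpos'
    rwa [← mul_assoc, ← Complex.ofReal_mul, inv_mul_cancel₀ hC.ne', Complex.ofReal_one,
      one_mul] at this
  refine of_tendsto (l := 𝓝[>] (0 : ℝ))
    (F := fun ε t => ((((Real.pi / (4 * l)⁻¹) ^ ((d : ℝ) / 2))⁻¹ : ℝ) : ℂ) * (f ε t : ℂ)) ?_ ?_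
  · filter_upwards [self_mem_nhdsWithin] with ε hε
    exact (const (by positivity)).mul (main ε hε)
  · intro t
    have ht := hpos t
    simp only [← Complex.ofReal_mul]
    refine (Complex.continuous_ofReal.tendsto _).comp ?_
    refine Tendsto.mono_left ?_ nhdsWithin_le_nhds
    have hbt : b 0 t ≠ 0 := (hbpos 0 le_rfl t).ne'
    have hct : ContinuousAt (fun ε => ((Real.pi / (4 * l)⁻¹) ^ ((d : ℝ) / 2))⁻¹ * f ε t) 0 := by
      simp only [hf]
      have : ContinuousAt (fun ε => b ε t) 0 := by fun_prop
      fun_prop (disch := simp_all)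
    convert hct.tendsto using 2
    simp only [hf, hb, add_zero]
    rw [show Real.pi / ((4 * l)⁻¹ / h t) = (Real.pi / (4 * l)⁻¹) * h t by field_simp,
      Real.mul_rpow (by positivity) ht.le, neg_div (2 : ℝ), Real.rpow_neg ht.le,
      show -1 / (4 * ((4 * l)⁻¹ / h t)) = -l * h t by field_simp]
    have h1 : (Real.pi / (4 * l)⁻¹) ^ ((d : ℝ) / 2) ≠ 0 := by positivity
    have h2 : h t ^ ((d : ℝ) / 2) ≠ 0 := by positivity
    generalize (Real.pi / (4 * l)⁻¹) ^ ((d : ℝ) / 2) = A at *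
    generalize h t ^ ((d : ℝ) / 2) = A' at *
    field_simp

/-! ### Assembly over the `n` factors. -/

theorem isMultivariateLaplace_exp {n : ℕ} (v : Fin n → ℝ≥0) :
    IsMultivariateLaplace fun u => Real.exp (-∑ k, u k * (v k : ℝ)) :=
  ⟨Measure.dirac v, inferInstance, fun u _ => by rw [integral_dirac]⟩

theorem mainTheorem4 (n : ℕ) (E : Fin n → Type*)
    [∀ k, AddCommGroup (E k)] [∀ k, Module ℝ (E k)]
    (h : ∀ k, E k → ℝ) (hcont : ∀ k, IsFinitelyContinuous (h k))
    (hpos : ∀ k t, 0 < h k t)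
    (d : Fin n → ℕ) (hd : ∀ k, 1 ≤ d k) :
    (∀ φ : (Fin n → ℝ) → ℝ, IsMultivariateLaplace φ →
      IsPositiveDefiniteFun
        (fun p : (∀ k, EuclideanSpace ℝ (Fin (d k))) × (∀ k, E k) =>
          ((φ (fun k => ‖p.1 k‖ ^ 2 / h k (p.2 k)) *
            ∏ k, (h k (p.2 k)) ^ (-(d k : ℝ) / 2) : ℝ) : ℂ))) ↔
    (∀ k, ∀ l : ℝ, 0 < l →
      IsPositiveDefiniteFun (fun t : E k => ((Real.exp (-l * h k t) : ℝ) : ℂ))) := by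
  constructor
  · intro H k l hl
    refine IsPositiveDefiniteFun.exp_neg_mul_of_gaussian (hpos k) (hd k) hl ?_
    let v : Fin n → ℝ≥0 := Pi.single k (4 * l)⁻¹.toNNReal
    have hvk : (v k : ℝ) = (4 * l)⁻¹ := by
      simp only [v, Pi.single_eq_same]
      exact Real.coe_toNNReal _ (by positivity)
    have hvj : ∀ j, j ≠ k → v j = 0 := fun j hj => Pi.single_eq_of_ne hj _
    let F : EuclideanSpace ℝ (Fin (d k)) × E k →+
        (∀ k, EuclideanSpace ℝ (Fin (d k))) × (∀ k, E k) :=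
      (AddMonoidHom.single (fun k => EuclideanSpace ℝ (Fin (d k))) k).prodMap
        (AddMonoidHom.single E k)
    -- Along `F` the other coordinates vanish, so their factors form a positive constant to divide
    -- out.
    let c : ℝ := ∏ j ∈ Finset.univ.erase k, h j 0 ^ (-(d j : ℝ) / 2)
    have hc : 0 < c := Finset.prod_pos fun j _ => Real.rpow_pos_of_pos (hpos j 0) _
    convert (IsPositiveDefiniteFun.const (inv_nonneg.2 hc.le)).mul
      ((H _ (isMultivariateLaplace_exp v)).comp F) using 2 with p
    rw [← Complex.ofReal_mul]
    congr 1
    have hsum : ∑ j, ‖(F p).1 j‖ ^ 2 / h j ((F p).2 j) * (v j : ℝ) =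
        ‖p.1‖ ^ 2 / h k p.2 * (4 * l)⁻¹ := by
      rw [Finset.sum_eq_single k]
      · rw [hvk]
        simp [F]
      · intro j _ hj
        simp [hvj j hj]
      · simp
    have hprod : ∏ j, h j ((F p).2 j) ^ (-(d j : ℝ) / 2) = h k p.2 ^ (-(d k : ℝ) / 2) * c := by
      rw [← Finset.mul_prod_erase _ _ (Finset.mem_univ k)]
      congr 1
      · simp [F]
      · refine Finset.prod_congr rfl fun j hj => ?_
        simp [F, Pi.single_eq_of_ne (Finset.ne_of_mem_erase hj)]
    rw [hsum, hprod]
    field_simp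
  · rintro H φ ⟨μ, hμ, hφ⟩
    have hI := IsPositiveDefiniteFun.integral (μ := μ)
      (F := fun v (p : (∀ k, EuclideanSpace ℝ (Fin (d k))) × (∀ k, E k)) =>
        ∏ k, ((Real.exp (-(‖p.1 k‖ ^ 2 / h k (p.2 k) * (v k : ℝ))) *
          h k (p.2 k) ^ (-(d k : ℝ) / 2) : ℝ) : ℂ))
      (fun v => IsPositiveDefiniteFun.prod _ fun k _ =>
        (IsPositiveDefiniteFun.exp_neg_mul_sq_norm_div (hpos k) (d k) (H k) (v k).2).comp
          ((Pi.evalAddMonoidHom (fun k => EuclideanSpace ℝ (Fin (d k))) k).prodMap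
            (Pi.evalAddMonoidHom E k)))
      (fun p => by
        refine Integrable.of_bound (Continuous.aestronglyMeasurable (by fun_prop))
          (∏ k, h k (p.2 k) ^ (-(d k : ℝ) / 2)) (Eventually.of_forall fun v => ?_)
        rw [norm_prod]
        refine Finset.prod_le_prod (fun _ _ => norm_nonneg _) fun k _ => ?_
        have hk := hpos k (p.2 k)
        rw [Complex.norm_real, Real.norm_of_nonneg (by positivity)]
        refine mul_le_of_le_one_left (by positivity) (Real.exp_le_one_iff.2 ?_)
        rw [neg_nonpos]
        positivity)
    convert hI using 2 with p
    rw [hφ _ fun k => div_nonneg (sq_nonneg _) (hpos k _).le, ← integral_mul_const,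
      ← integral_complex_ofReal]
    refine integral_congr_ae (Eventually.of_forall fun v => ?_)
    simp only []
    rw [← Complex.ofReal_prod, Finset.prod_mul_distrib, ← Real.exp_sum, Finset.sum_neg_distrib]
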